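/- Let $\alpha>0$ and, for $t>0$, let $w(x,t)=(1-x^2)^{\alpha}e^{-t/(1-x^2)}$ on $[-1,1]$. Let $P_n(x,t)$, $n=0,1,2,\ldots$, be the monic polynomials of degree $n$ in $x$ with $\int_{-1}^{1}P_m(x,t)P_n(x,t)w(x,t)\,dx=h_n(t)\delta_{mn}$, and define, for $t>0$, $$R_n(t)=\frac{2t}{h_n(t)}\int_{-1}^{1}\frac{P_n(y,t)^2\,w(y,t)}{1-y^2}\,dy\quad(n\ge 0),\qquad r_n(t)=\frac{2t}{h_{n-1}(t)}\int_{-1}^{1}\frac{y\,P_n(y,t)P_{n-1}(y,t)\,w(y,t)}{1-y^2}\,dy\quad(n\ge 1),\qquad r_0(t)=0.$$ Then, for every integer $n\ge 0$, $R_n$ and $r_n$ are twice continuously differentiable on $(0,\infty)$ and satisfy there the following second-order nonlinear ordinary differential equations (where $'=d/dt$): $$\begin{aligned}&8t^2R_n(2n+1+2\alpha+R_n)R_n''-4t^2(4n+2+4\alpha+3R_n)(R_n')^2+8tR_n(2n+1+2\alpha+R_n)R_n'-R_n^5-2(2n+1+2\alpha)R_n^4\\&\quad-4\left[(n+\alpha)(n+1+\alpha)-t(t-2\alpha)\right]R_n^3+16t(2n+1+2\alpha)(t-\alpha)R_n^2\\&\quad+4t(2n+1+2\alpha)^2(5t-2\alpha)R_n+8t^2(2n+1+2\alpha)^3=0,\end{aligned}$$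 $$\begin{aligned}&4t^2r_n(2t+r_n)r_n''-4t^2(t+r_n)(r_n')^2+4t\,r_n^2\,r_n'-r_n^5-(2n+2\alpha+5t)r_n^4-8t(n+\alpha+t)r_n^3\\&\quad-4t\left[(t+\alpha)^2+n(2t+\alpha)-1\right]r_n^2+4n^2t^2r_n+4n^2t^3=0.\end{aligned}$$ Moreover, the function $$W_n(t)=\frac{2n+1+2\alpha+R_n(t)}{2n+1+2\alpha}$$ takes neither of the values $0,1$ on $(0,\infty)$ and satisfies there the Painlevé V equation $$W_n''=\frac{(3W_n-1)(W_n')^2}{2W_n(W_n-1)}-\frac{W_n'}{t}+\frac{(W_n-1)^2}{t^2}\left(\mu_1W_n+\frac{\mu_2}{W_n}\right)+\frac{\mu_3W_n}{t}+\frac{\mu_4W_n(W_n+1)}{W_n-1}$$ with $$\mu_1=\frac{(2n+1+2\alpha)^2}{8},\qquad \mu_2=-\frac18,\qquad \mu_3=\alpha,\qquad \mu_4=-\frac12.$$ -/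

import Mathlib

open Polynomial

noncomputable section

namespace PollaczekJacobi

/-- The symmetric Pollaczek-Jacobi type weight `w(x,t) = (1-x²)^α exp(-t/(1-x²))`,
used only for `x ∈ [-1,1]`, `α > 0`, `t > 0`.  (At the two endpoints its value is `0`,
because `0 ^ α = 0` for `α > 0`.) -/
def weight (α t x : ℝ) : ℝ :=
  (1 - x ^ 2) ^ α * Real.exp (-(t / (1 - x ^ 2)))

/-- The bilinear form `∫_{-1}^{1} p(x) q(x) w(x,t) dx` on real polynomials. -/
def innerW (α t : ℝ) (p q : ℝ[X]) : ℝ :=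
  ∫ x in (-1 : ℝ)..1, p.eval x * q.eval x * weight α t x

/-- The monic orthogonal polynomials `P_n(·,t)` for the weight, by the Gram-Schmidt process
applied to `1, x, x², …`.  The facts `P_monic`, `P_natDegree` and `P_orthogonal` below
show that these are monic of degree `n` and mutually orthogonal. -/
def P (α t : ℝ) : ℕ → ℝ[X]
  | n => X ^ n - ∑ j : Fin n,
      C (innerW α t (P α t j) (X ^ n) / innerW α t (P α t j) (P α t j)) * P α t j
decreasing_by all_goals exact j.isLt

/-- The squared norm `h_n(t) = ∫_{-1}^{1} P_n(x,t)² w(x,t) dx`. -/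
def h (α t : ℝ) (n : ℕ) : ℝ := innerW α t (P α t n) (P α t n)

/-- `R_n(t) = (2t / h_n(t)) ∫_{-1}^{1} P_n(y,t)² w(y,t) / (1-y²) dy`. -/
def R (α : ℝ) (n : ℕ) (t : ℝ) : ℝ :=
  2 * t / h α t n *
    ∫ y in (-1 : ℝ)..1, 1 / (1 - y ^ 2) * (P α t n).eval y ^ 2 * weight α t y

/-- `r_n(t) = (2t / h_{n-1}(t)) ∫_{-1}^{1} y P_n(y,t) P_{n-1}(y,t) w(y,t) / (1-y²) dy`
for `n ≥ 1`, and `r_0(t) = 0` (since `P_{-1} = 0`). -/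
def r (α : ℝ) : ℕ → ℝ → ℝ
  | 0, _ => 0
  | n + 1, t => 2 * t / h α t n *
      ∫ y in (-1 : ℝ)..1,
        y / (1 - y ^ 2) * (P α t (n + 1)).eval y * (P α t n).eval y * weight α t y

/-- `W_n(t) = (2n+1+2α+R_n(t)) / (2n+1+2α)`. -/
def W (α : ℝ) (n : ℕ) (t : ℝ) : ℝ :=
  (2 * n + 1 + 2 * α + R α n t) / (2 * n + 1 + 2 * α)

/-- `y` is a (classical) solution on `(0,∞)` of the fifth Painlevé equation with parameters
`μ₁, μ₂, μ₃, μ₄`.  The values `0` and `1`, at which the right-hand side has a vanishing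
denominator, are excluded. -/
def SolvesPainleveV (μ₁ μ₂ μ₃ μ₄ : ℝ) (y : ℝ → ℝ) : Prop :=
  ContDiffOn ℝ 2 y (Set.Ioi 0) ∧
  ∀ t : ℝ, 0 < t → y t ≠ 0 ∧ y t ≠ 1 ∧
    deriv (deriv y) t =
      (3 * y t - 1) * (deriv y t) ^ 2 / (2 * y t * (y t - 1))
      - deriv y t / t
      + (y t - 1) ^ 2 / t ^ 2 * (μ₁ * y t + μ₂ / y t)
      + μ₃ * y t / t
      + μ₄ * y t * (y t + 1) / (y t - 1)

/-! Basic facts: the polynomials `P α t n` are the monic orthogonal polynomials. -/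

theorem P_eq (α t : ℝ) (n : ℕ) :
    P α t n = X ^ n - ∑ j : Fin n,
      C (innerW α t (P α t j) (X ^ n) / innerW α t (P α t j) (P α t j)) * P α t j := by
  conv_lhs => rw [P]

theorem P_monic_natDegree (α t : ℝ) (n : ℕ) :
    (P α t n).Monic ∧ (P α t n).natDegree = n := by
  induction n using Nat.strong_induction_on with
  | _ n ih =>
    have hlt : (∑ j : Fin n,
        C (innerW α t (P α t j) (X ^ n) / innerW α t (P α t j) (P α t j)) *
          P α t j).degree < (n : WithBot ℕ) := by
      refine lt_of_le_of_lt (degree_sum_le _ _) ?_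
      refine (Finset.sup_lt_iff (WithBot.bot_lt_coe n)).2 ?_
      intro j _
      rw [← smul_eq_C_mul]
      refine lt_of_le_of_lt (degree_smul_le _ _) ?_
      rw [degree_eq_natDegree (ih j j.isLt).1.ne_zero, (ih j j.isLt).2]
      exact Nat.cast_lt.2 j.isLt
    have hm : (P α t n).Monic := by
      rw [P_eq]
      exact monic_X_pow_sub (by exact_mod_cast hlt)
    refine ⟨hm, ?_⟩
    apply natDegree_eq_of_degree_eq_some
    rw [P_eq, degree_sub_eq_left_of_degree_lt (by rwa [degree_X_pow]), degree_X_pow]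

theorem P_monic (α t : ℝ) (n : ℕ) : (P α t n).Monic := (P_monic_natDegree α t n).1

theorem P_natDegree (α t : ℝ) (n : ℕ) : (P α t n).natDegree = n :=
  (P_monic_natDegree α t n).2

theorem weight_intervalIntegrable {α t : ℝ} (hα : 0 < α) (ht : 0 < t) :
    IntervalIntegrable (weight α t) MeasureTheory.volume (-1) 1 := by
  rw [intervalIntegrable_iff_integrableOn_Icc_of_le (by norm_num)]
  refine MeasureTheory.Measure.integrableOn_of_bounded (M := 1) (by simp) ?_ ?_
  · apply Measurable.aestronglyMeasurable
    unfold weight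
    fun_prop
  · refine (MeasureTheory.ae_restrict_mem measurableSet_Icc).mono fun x hx => ?_
    have h0 : 0 ≤ 1 - x ^ 2 := by nlinarith [hx.1, hx.2]
    have h1 : 1 - x ^ 2 ≤ 1 := by nlinarith [sq_nonneg x]
    have ha := Real.rpow_nonneg h0 α
    have hb := Real.rpow_le_one h0 h1 hα.le
    have hc : Real.exp (-(t / (1 - x ^ 2))) ≤ 1 := by
      rw [Real.exp_le_one_iff]
      have := div_nonneg ht.le h0
      linarith
    unfold weight
    rw [Real.norm_eq_abs, abs_of_nonneg (mul_nonneg ha (Real.exp_pos _).le)]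
    exact mul_le_one₀ hb (Real.exp_pos _).le hc

theorem innerW_intervalIntegrable {α t : ℝ} (hα : 0 < α) (ht : 0 < t) (p q : ℝ[X]) :
    IntervalIntegrable (fun x => p.eval x * q.eval x * weight α t x)
      MeasureTheory.volume (-1) 1 :=
  (weight_intervalIntegrable hα ht).continuousOn_mul
    ((p.continuous.mul q.continuous).continuousOn)

theorem innerW_comm (α t : ℝ) (p q : ℝ[X]) : innerW α t p q = innerW α t q p := by
  unfold innerW
  simp only [mul_comm (p.eval _)]

theorem innerW_sub_right {α t : ℝ} (hα : 0 < α) (ht : 0 < t) (p q s : ℝ[X]) :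
    innerW α t p (q - s) = innerW α t p q - innerW α t p s := by
  unfold innerW
  rw [← intervalIntegral.integral_sub (innerW_intervalIntegrable hα ht p q)
    (innerW_intervalIntegrable hα ht p s)]
  congr 1
  ext x
  rw [eval_sub]
  ring

theorem innerW_sum_right {α t : ℝ} (hα : 0 < α) (ht : 0 < t) (p : ℝ[X]) {n : ℕ}
    (c : Fin n → ℝ) (q : Fin n → ℝ[X]) :
    innerW α t p (∑ j, C (c j) * q j) = ∑ j, c j * innerW α t p (q j) := by
  unfold innerW
  simp only [← intervalIntegral.integral_const_mul]
  rw [← intervalIntegral.integral_finsetSum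
    (fun j _ => (innerW_intervalIntegrable hα ht p (q j)).const_mul (c j))]
  congr 1
  ext x
  rw [eval_finsetSum, Finset.mul_sum, Finset.sum_mul]
  refine Finset.sum_congr rfl fun j _ => ?_
  rw [eval_mul, eval_C]
  ring

theorem innerW_self_pos {α t : ℝ} (hα : 0 < α) (ht : 0 < t) {p : ℝ[X]} (hp : p ≠ 0) :
    0 < innerW α t p p := by
  unfold innerW
  have hnn : ∀ x ∈ Set.Ioc (-1 : ℝ) 1, 0 ≤ p.eval x * p.eval x * weight α t x := by
    intro x hx
    have h0 : 0 ≤ 1 - x ^ 2 := by nlinarith [hx.1, hx.2]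
    exact mul_nonneg (mul_self_nonneg _)
      (mul_nonneg (Real.rpow_nonneg h0 α) (Real.exp_pos _).le)
  rw [intervalIntegral.integral_pos_iff_support_of_nonneg_ae'
    (by
      rw [Set.uIoc_of_le (by norm_num : (-1 : ℝ) ≤ 1)]
      exact (MeasureTheory.ae_restrict_mem measurableSet_Ioc).mono hnn)
    (innerW_intervalIntegrable hα ht p p)]
  refine ⟨by norm_num, ?_⟩
  have hsub : Set.Ioo (-1 : ℝ) 1 \ (p.roots.toFinset : Set ℝ) ⊆
      Function.support (fun x => p.eval x * p.eval x * weight α t x) ∩ Set.Ioc (-1) 1 := by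
    rintro x ⟨hx, hr⟩
    refine ⟨?_, Set.Ioo_subset_Ioc_self hx⟩
    have hev : p.eval x ≠ 0 := by
      intro h0
      apply hr
      simp [hp, h0]
    have h0 : 0 < 1 - x ^ 2 := by nlinarith [hx.1, hx.2]
    exact mul_ne_zero (mul_ne_zero hev hev)
      (mul_pos (Real.rpow_pos_of_pos h0 α) (Real.exp_pos _)).ne'
  refine lt_of_lt_of_le ?_ (MeasureTheory.measure_mono hsub)
  rw [MeasureTheory.measure_sdiff_null (Finset.measure_zero _ _), Real.volume_Ioo]
  norm_num

theorem h_pos {α t : ℝ} (hα : 0 < α) (ht : 0 < t) (n : ℕ) : 0 < h α t n :=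
  innerW_self_pos hα ht (P_monic α t n).ne_zero

theorem P_orthogonal_of_lt {α t : ℝ} (hα : 0 < α) (ht : 0 < t) (n : ℕ) :
    ∀ m < n, innerW α t (P α t m) (P α t n) = 0 := by
  induction n using Nat.strong_induction_on with
  | _ n ih =>
    intro m hm
    have hs := (h_pos hα ht m).ne'
    rw [P_eq α t n, innerW_sub_right hα ht, innerW_sum_right hα ht,
      Finset.sum_eq_single (⟨m, hm⟩ : Fin n)]
    · unfold h at hs
      field_simp
      ring
    · intro j _ hj
      have hne : (j : ℕ) ≠ m := fun e => hj (Fin.ext e)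
      rcases lt_or_gt_of_ne hne with hl | hg
      · rw [innerW_comm α t (P α t m), ih m hm j hl, mul_zero]
      · rw [ih j j.isLt m hg, mul_zero]
    · simp

/-- Orthogonality: `∫ P_m P_n w = h_n δ_{mn}`. -/
theorem P_orthogonal {α t : ℝ} (hα : 0 < α) (ht : 0 < t) (m n : ℕ) :
    innerW α t (P α t m) (P α t n) = if m = n then h α t n else 0 := by
  split_ifs with e
  · rw [e, h]
  · rcases lt_or_gt_of_ne e with hl | hg
    · exact P_orthogonal_of_lt hα ht n m hl
    · rw [innerW_comm]
      exact P_orthogonal_of_lt hα ht m n hg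

end PollaczekJacobi

end

namespace PollaczekJacobi

open MeasureTheory Set

/-! Write `w_β` for the weight with exponent `β`. The exponential beats every power of `1 - x²` at
the endpoints, so `β` may be any real number. Dividing by `1 - x²` lowers `β` by one, and `∂_t w_β =
-w_{β-1}`. Thus `R_n`, `r_n` and all `t`-derivatives are integrals of polynomials against `w_α` and
`w_{α-1}`.

Let `β_n = h_n / h_{n-1}` and let `p_n` be the coefficient of `x^(n-2)` in `P_n`. Parity and
orthogonality give `x P_n = P_{n+1} + β_n P_{n-1}`. This yields `r_{n+1} + r_n = R_n - 2t` and a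
companion formula for `r_{n+1} - r_n`. Integration by parts expresses `p_{n+1}` through `r_n` and
`β_n` (`two_mul_coeff_P`). Telescoping these in `n` gives two relations among `r_n`, `β_n R_n` and
`β_n R_{n-1}` (`quadratic_relations`).

Differentiating the norm and orthogonality integrals in `t` gives `β_n'` and `p_{n+1}'`, hence
`r_n'`. As `R_n > 0`, the quadratic relations eliminate `β_n` and `R_{n-1}`, leaving a closed
first-order system for `(r_n, R_n)` (`r_hasDerivAt`, `R_hasDerivAt`). Smoothness follows by
bootstrapping. Differentiating the system once more turns both second-order equations into rational
identities in `t, r_n, R_n`, and Painlevé V is the `R_n` equation after an affine change of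
variable. -/

/-- The integral of a polynomial against the weight; the exponent may be any real number. -/
noncomputable def weightedIntegral (β t : ℝ) (p : ℝ[X]) : ℝ :=
  ∫ x in (-1 : ℝ)..1, p.eval x * weight β t x

/-! ### Weighted integrals for an arbitrary real exponent -/

theorem one_sub_sq_pos {x : ℝ} (hx : x ∈ Ioo (-1 : ℝ) 1) : 0 < 1 - x ^ 2 := by
  nlinarith [hx.1, hx.2]

theorem weight_nonneg (β t : ℝ) {x : ℝ} (hx : x ∈ Icc (-1 : ℝ) 1) : 0 ≤ weight β t x :=
  mul_nonneg (Real.rpow_nonneg (by nlinarith [hx.1, hx.2]) β) (Real.exp_pos _).le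

/-- With `s = 1 - x²` and `N = ⌈-β⌉₊`, the power `s^β` is at most `s^(-N)`, while one term of the
exponential series gives `exp(t/s) ≥ (t/s)^N / N!`; the powers of `s` cancel. -/
theorem weight_le {β t x : ℝ} (ht : 0 < t) (hx : x ∈ Ioo (-1 : ℝ) 1) :
    weight β t x ≤ (⌈-β⌉₊).factorial / t ^ ⌈-β⌉₊ := by
  have h0 := one_sub_sq_pos hx
  have h1 : 1 - x ^ 2 ≤ 1 := by nlinarith [sq_nonneg x]
  set s := 1 - x ^ 2 with hs
  set N := ⌈-β⌉₊
  have hN : -β ≤ N := Nat.le_ceil _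
  have ha : s ^ β ≤ (s⁻¹) ^ N := by
    rw [inv_pow, ← Real.rpow_natCast, ← Real.rpow_neg h0.le]
    exact Real.rpow_le_rpow_of_exponent_ge h0 h1 (by linarith)
  have hb := Real.pow_div_factorial_le_exp (x := t / s) (by positivity) N
  have hf : (0 : ℝ) < N.factorial := by exact_mod_cast N.factorial_pos
  unfold weight
  rw [← hs, Real.exp_neg]
  calc s ^ β * (Real.exp (t / s))⁻¹ ≤ (s⁻¹) ^ N * ((t / s) ^ N / N.factorial)⁻¹ := by
        gcongr
    _ = N.factorial / t ^ N := by
        field_simp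
        ring

theorem weight_measurable (β t : ℝ) : Measurable (weight β t) := by
  unfold weight
  fun_prop

theorem ae_mem_Ioo :
    ∀ᵐ x : ℝ, x ∈ uIoc (-1 : ℝ) 1 → x ∈ Ioo (-1 : ℝ) 1 := by
  have : ∀ᵐ x : ℝ, x ≠ 1 := by simp [ae_iff]
  filter_upwards [this] with x hx h
  rw [uIoc_of_le (by norm_num)] at h
  exact ⟨h.1, lt_of_le_of_ne h.2 hx⟩

theorem weight_intervalIntegrable' (β : ℝ) {t : ℝ} (ht : 0 < t) :
    IntervalIntegrable (weight β t) volume (-1) 1 := by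
  rw [intervalIntegrable_iff_integrableOn_Ioo_of_le (by norm_num)]
  refine Measure.integrableOn_of_bounded (M := (⌈-β⌉₊).factorial / t ^ ⌈-β⌉₊) (by simp)
    (weight_measurable β t).aestronglyMeasurable ?_
  refine (ae_restrict_mem measurableSet_Ioo).mono fun x hx => ?_
  rw [Real.norm_of_nonneg (weight_nonneg _ _ (Ioo_subset_Icc_self hx))]
  exact weight_le ht hx

theorem eval_mul_weight_intervalIntegrable (β : ℝ) {t : ℝ} (ht : 0 < t) (p : ℝ[X]) :
    IntervalIntegrable (fun x => p.eval x * weight β t x) volume (-1) 1 :=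
  (weight_intervalIntegrable' β ht).continuousOn_mul p.continuous.continuousOn

theorem weightedIntegral_add (β : ℝ) {t : ℝ} (ht : 0 < t) (p q : ℝ[X]) :
    weightedIntegral β t (p + q) = weightedIntegral β t p + weightedIntegral β t q := by
  unfold weightedIntegral
  rw [← intervalIntegral.integral_add (eval_mul_weight_intervalIntegrable β ht p)
    (eval_mul_weight_intervalIntegrable β ht q)]
  simp only [eval_add, add_mul]

theorem weightedIntegral_C_mul (β t c : ℝ) (p : ℝ[X]) :
    weightedIntegral β t (C c * p) = c * weightedIntegral β t p := by
  unfold weightedIntegral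
  rw [← intervalIntegral.integral_const_mul]
  simp only [eval_mul, eval_C, mul_assoc]

theorem weightedIntegral_sub (β : ℝ) {t : ℝ} (ht : 0 < t) (p q : ℝ[X]) :
    weightedIntegral β t (p - q) = weightedIntegral β t p - weightedIntegral β t q := by
  unfold weightedIntegral
  rw [← intervalIntegral.integral_sub (eval_mul_weight_intervalIntegrable β ht p)
    (eval_mul_weight_intervalIntegrable β ht q)]
  simp only [eval_sub, sub_mul]

theorem weightedIntegral_eq_sum (β : ℝ) {t : ℝ} (ht : 0 < t) {p : ℝ[X]} {N : ℕ}
    (hp : p.natDegree < N) :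
    weightedIntegral β t p =
      ∑ k ∈ Finset.range N, p.coeff k * weightedIntegral β t (X ^ k) := by
  unfold weightedIntegral
  simp only [← intervalIntegral.integral_const_mul]
  rw [← intervalIntegral.integral_finsetSum
    (fun j _ => (eval_mul_weight_intervalIntegrable β ht (X ^ j)).const_mul _)]
  congr 1
  ext x
  rw [eval_eq_sum_range' hp, Finset.sum_mul]
  refine Finset.sum_congr rfl fun k _ => ?_
  simp [mul_assoc]

theorem innerW_eq (α t : ℝ) (p q : ℝ[X]) : innerW α t p q = weightedIntegral α t (p * q) := by
  simp only [innerW, weightedIntegral, eval_mul]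

theorem weight_sub_one {β t x : ℝ} (hx : x ∈ Ioo (-1 : ℝ) 1) :
    weight (β - 1) t x = 1 / (1 - x ^ 2) * weight β t x := by
  have h0 := one_sub_sq_pos hx
  unfold weight
  rw [Real.rpow_sub_one h0.ne']
  ring

theorem weightedIntegral_sub_one (β t : ℝ) (p : ℝ[X]) :
    weightedIntegral (β - 1) t p =
      ∫ x in (-1 : ℝ)..1, 1 / (1 - x ^ 2) * p.eval x * weight β t x := by
  refine intervalIntegral.integral_congr_ae (ae_mem_Ioo.mono fun x hx h => ?_)
  rw [weight_sub_one (hx h)]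
  ring

theorem weightedIntegral_sub_one_mul (β t : ℝ) (p : ℝ[X]) :
    weightedIntegral (β - 1) t ((1 - X ^ 2) * p) = weightedIntegral β t p := by
  refine intervalIntegral.integral_congr_ae (ae_mem_Ioo.mono fun x hx h => ?_)
  have h0 := (one_sub_sq_pos (hx h)).ne'
  simp only [weight_sub_one (hx h), eval_mul, eval_sub, eval_one, eval_pow, eval_X]
  field_simp

theorem weightedIntegral_comp_neg (β t : ℝ) (p : ℝ[X]) :
    weightedIntegral β t (p.comp (-X)) = weightedIntegral β t p := by
  have := intervalIntegral.integral_comp_neg (a := -1) (b := 1)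
    (fun x : ℝ => p.eval x * weight β t x)
  simp only [neg_neg] at this
  unfold weightedIntegral
  rw [← this]
  simp [weight]

/-! ### Derivatives of the weight and integration by parts -/

theorem weight_hasDerivAt {β t x : ℝ} (hx : x ∈ Ioo (-1 : ℝ) 1) :
    HasDerivAt (fun s => weight β s x) (-weight (β - 1) t x) t := by
  have h0 := (one_sub_sq_pos hx).ne'
  have h1 : HasDerivAt (fun s : ℝ => -(s / (1 - x ^ 2))) (-(1 / (1 - x ^ 2))) t :=
    ((hasDerivAt_id t).div_const _).neg
  rw [weight_sub_one hx]
  unfold weight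
  refine (h1.exp.const_mul ((1 - x ^ 2) ^ β)).congr_deriv ?_
  ring

theorem weight_anti {β s t x : ℝ} (hst : s ≤ t) (hx : x ∈ Ioo (-1 : ℝ) 1) :
    weight β t x ≤ weight β s x := by
  have h0 := one_sub_sq_pos hx
  unfold weight
  gcongr

theorem weightedIntegral_hasDerivAt (β : ℝ) {t : ℝ} (ht : 0 < t) (p : ℝ[X]) :
    HasDerivAt (fun s => weightedIntegral β s p) (-weightedIntegral (β - 1) t p) t := by
  -- The weight decreases in `t`, so on the ball of radius `t/2` its value at time `t/2` dominates.
  have key := intervalIntegral.hasDerivAt_integral_of_dominated_loc_of_deriv_le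
    (μ := volume) (a := -1) (b := 1) (s := Metric.ball t (t / 2)) (x₀ := t)
    (F := fun s x => p.eval x * weight β s x)
    (F' := fun s x => -(p.eval x * weight (β - 1) s x))
    (bound := fun x => |p.eval x| * weight (β - 1) (t / 2) x)
    (Metric.ball_mem_nhds t (by positivity))
    (.of_forall fun s => (p.continuous.measurable.mul (weight_measurable β s)).aestronglyMeasurable)
    (eval_mul_weight_intervalIntegrable β ht p)
    (p.continuous.measurable.mul (weight_measurable (β - 1) t)).neg.aestronglyMeasurable
    (ae_mem_Ioo.mono fun x hx h s hs => ?_)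
    ((weight_intervalIntegrable' (β - 1) (half_pos ht)).continuousOn_mul
      p.continuous.abs.continuousOn)
    (ae_mem_Ioo.mono fun x hx h s hs => ?_)
  · have := key.2
    rwa [intervalIntegral.integral_neg] at this
  · have hs' : t / 2 ≤ s := by
      rw [Metric.mem_ball, Real.dist_eq, abs_lt] at hs
      linarith [hs.1]
    rw [norm_neg, norm_mul, Real.norm_eq_abs,
      Real.norm_of_nonneg (weight_nonneg _ _ (Ioo_subset_Icc_self (hx h)))]
    exact mul_le_mul_of_nonneg_left (weight_anti hs' (hx h)) (abs_nonneg _)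
  · exact ((weight_hasDerivAt (β := β) (t := s) (hx h)).const_mul (p.eval x)).congr_deriv
      (mul_neg _ _)

/-- The factor `1 - y²` absorbs one of the two powers of `1/(1 - y²)` produced by differentiating
the exponential, so only exponents `α` and `α - 1` occur. -/
theorem weight_hasDerivAt_right {α t x : ℝ} (hx : x ∈ Ioo (-1 : ℝ) 1) :
    HasDerivAt (fun y => (1 - y ^ 2) * weight α t y)
      (-2 * x * weight α t x - 2 * α * x * weight α t x - 2 * t * x * weight (α - 1) t x) x := by
  have h0 := one_sub_sq_pos hx
  have h1 : HasDerivAt (fun y : ℝ => 1 - y ^ 2) (-(2 * x)) x := by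
    simpa using (hasDerivAt_pow 2 x).const_sub 1
  have h2 := h1.rpow_const (p := α) (Or.inl h0.ne')
  have h3 := (((hasDerivAt_const x t).div h1 h0.ne').neg).exp
  rw [weight_sub_one hx]
  unfold weight
  refine (h1.mul (h2.mul h3)).congr_deriv ?_
  rw [Real.rpow_sub_one h0.ne']
  simp only [Pi.mul_apply, Pi.neg_apply, Pi.div_apply]
  field_simp
  ring

theorem continuousOn_one_sub_sq_mul_weight {α t : ℝ} (hα : 0 < α) (ht : 0 < t) :
    ContinuousOn (fun y => (1 - y ^ 2) * weight α t y) (Icc (-1) 1) := by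
  intro x hx
  rcases eq_or_ne (1 - x ^ 2) 0 with h0 | h0
  · have hb : ∀ y ∈ Icc (-1 : ℝ) 1, ‖(1 - y ^ 2) * weight α t y‖ ≤ 1 - y ^ 2 := by
      intro y hy
      have h1 : 0 ≤ 1 - y ^ 2 := by nlinarith [hy.1, hy.2]
      have h2 : weight α t y ≤ 1 := mul_le_one₀
        (Real.rpow_le_one h1 (by nlinarith [sq_nonneg y]) hα.le) (Real.exp_pos _).le
        (by rw [Real.exp_le_one_iff]; have := div_nonneg ht.le h1; linarith)
      rw [Real.norm_of_nonneg (mul_nonneg h1 (weight_nonneg _ _ hy))]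
      exact mul_le_of_le_one_right h1 h2
    have hlim : Filter.Tendsto (fun y : ℝ => 1 - y ^ 2) (nhdsWithin x (Icc (-1) 1))
        (nhds 0) := by
      have : ContinuousWithinAt (fun y : ℝ => 1 - y ^ 2) (Icc (-1) 1) x := by fun_prop
      simpa [ContinuousWithinAt, h0] using this
    have := squeeze_zero_norm' (f := fun y => (1 - y ^ 2) * weight α t y)
      (Filter.eventually_of_mem self_mem_nhdsWithin hb) hlim
    simpa [ContinuousWithinAt, h0] using this
  · have hx' : x ∈ Ioo (-1 : ℝ) 1 :=
      ⟨lt_of_le_of_ne hx.1 fun e => h0 (by rw [← e]; norm_num),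
        lt_of_le_of_ne hx.2 fun e => h0 (by rw [e]; norm_num)⟩
    exact (weight_hasDerivAt_right hx').continuousAt.continuousWithinAt

/-- Integration by parts against the weight. -/
theorem weightedIntegral_derivative {α t : ℝ} (hα : 0 < α) (ht : 0 < t) (q : ℝ[X]) :
    weightedIntegral α t ((1 - X ^ 2) * derivative q) =
      (2 * α + 2) * weightedIntegral α t (X * q) +
        2 * t * weightedIntegral (α - 1) t (X * q) := by
  have hi := ((eval_mul_weight_intervalIntegrable α ht ((1 - X ^ 2) * derivative q)).sub
    ((eval_mul_weight_intervalIntegrable α ht (X * q)).const_mul (2 * α + 2))).sub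
    ((eval_mul_weight_intervalIntegrable (α - 1) ht (X * q)).const_mul (2 * t))
  have key := intervalIntegral.integral_eq_sub_of_hasDerivAt_of_le (by norm_num : (-1 : ℝ) ≤ 1)
    (f := fun y => q.eval y * ((1 - y ^ 2) * weight α t y))
    (q.continuous.continuousOn.mul (continuousOn_one_sub_sq_mul_weight hα ht))
    (fun x hx => ((q.hasDerivAt x).mul (weight_hasDerivAt_right hx)).congr_deriv
      (by
        simp only [eval_mul, eval_sub, eval_one, eval_pow, eval_X]
        ring)) hi
  rw [intervalIntegral.integral_sub, intervalIntegral.integral_sub,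
    intervalIntegral.integral_const_mul, intervalIntegral.integral_const_mul] at key
  · have hz : ∀ a b : ℝ, a * ((1 - (1 : ℝ) ^ 2) * b) = 0 := by intros; ring
    have hz' : ∀ a b : ℝ, a * ((1 - (-1 : ℝ) ^ 2) * b) = 0 := by intros; ring
    rw [hz, hz'] at key
    unfold weightedIntegral
    linarith
  · exact eval_mul_weight_intervalIntegrable _ ht _
  · exact (eval_mul_weight_intervalIntegrable _ ht _).const_mul _
  · exact (eval_mul_weight_intervalIntegrable α ht ((1 - X ^ 2) * derivative q)).sub
      ((eval_mul_weight_intervalIntegrable α ht (X * q)).const_mul (2 * α + 2))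
  · exact (eval_mul_weight_intervalIntegrable _ ht _).const_mul _

/-! ### Parity, orthogonality and the three-term recurrence -/

theorem coeff_P_self (α t : ℝ) (n : ℕ) : (P α t n).coeff n = 1 := by
  have := (P_monic α t n).coeff_natDegree
  rwa [P_natDegree] at this

/-- Since the weight is even, reflecting the integral shows that the Gram-Schmidt coefficient of
`P_j` in `P_n` vanishes unless `j` and `n` have the same parity. -/
theorem P_comp_neg (α t : ℝ) (n : ℕ) : (P α t n).comp (-X) = C ((-1) ^ n) * P α t n := by
  induction n using Nat.strong_induction_on with
  | _ n ih =>
    conv_lhs => rw [P_eq]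
    conv_rhs => rw [P_eq]
    rw [sub_comp, mul_sub, Finset.mul_sum, sum_comp, X_pow_comp, neg_pow, C_pow, C_neg, C_1]
    congr 1
    refine Finset.sum_congr rfl fun j _ => ?_
    rw [mul_comp, C_comp, ih j j.isLt]
    have h1 : innerW α t (P α t j) (X ^ n) = (-1) ^ (j : ℕ) * (-1) ^ n *
        innerW α t (P α t j) (X ^ n) := by
      conv_lhs => rw [innerW_eq, ← weightedIntegral_comp_neg]
      rw [mul_comp, ih j j.isLt, X_pow_comp, neg_pow, innerW_eq, ← weightedIntegral_C_mul]
      congr 1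
      simp only [C_mul, C_pow, C_neg, C_1]
      ring
    have h2 : (-1 : ℝ) ^ (j : ℕ) * (-1) ^ (j : ℕ) = 1 := by
      rw [← mul_pow]; norm_num
    have h3 : innerW α t (P α t j) (X ^ n) * (-1) ^ (j : ℕ) =
        (-1) ^ n * innerW α t (P α t j) (X ^ n) := by
      conv_lhs => rw [h1]
      linear_combination ((-1) ^ n * innerW α t (P α t j) (X ^ n)) * h2
    have h4 : ((-1 : ℝ[X]) ^ n) = C ((-1) ^ n) := by simp
    rw [h4, ← mul_assoc, ← mul_assoc, ← C_mul, ← C_mul, div_mul_eq_mul_div, h3, mul_div_assoc]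

theorem coeff_P_succ (α t : ℝ) (n : ℕ) : (P α t (n + 1)).coeff n = 0 := by
  have h1 := congrArg (fun p => p.coeff n) (P_comp_neg α t (n + 1))
  have h0 : (-X : ℝ[X]) = C (-1) * X := by simp
  simp only [h0, comp_C_mul_X_coeff, coeff_C_mul, pow_succ] at h1
  have h2 : (-1 : ℝ) ^ n * (-1) ^ n = 1 := by
    rw [← mul_pow]; norm_num
  linear_combination ((-1) ^ n / 2) * h1 - (P α t (n + 1)).coeff n * h2

/-- Subtracting a multiple of the monic `P_d` removes the top coefficient of `q` at no cost to the
integral. The separate bound `d` serves the induction and treats `q = 0` uniformly. -/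
theorem weightedIntegral_P_mul_of_degree_lt {α t : ℝ} (hα : 0 < α) (ht : 0 < t) (n d : ℕ)
    (hd : d ≤ n) (q : ℝ[X]) (hq : ∀ k, d ≤ k → q.coeff k = 0) :
    weightedIntegral α t (P α t n * q) = 0 := by
  induction d generalizing q with
  | zero =>
    have : q = 0 := by ext k; simpa using hq k (Nat.zero_le k)
    simp [this, weightedIntegral]
  | succ d ih =>
    have h1 := ih (by omega) (q - C (q.coeff d) * P α t d) (fun k hk => by
      rcases hk.eq_or_lt with rfl | hk
      · simp [coeff_P_self]
      · rw [coeff_sub, coeff_C_mul, hq k hk,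
          coeff_eq_zero_of_natDegree_lt (p := P α t d) (by rwa [P_natDegree]), mul_zero, sub_zero])
    have h2 := P_orthogonal_of_lt hα ht n d (by omega)
    rw [innerW_comm, innerW_eq] at h2
    rwa [mul_sub, weightedIntegral_sub α ht, mul_left_comm, weightedIntegral_C_mul, h2, mul_zero,
      sub_zero] at h1

theorem h_eq (α t : ℝ) (n : ℕ) : h α t n = weightedIntegral α t (P α t n * P α t n) :=
  innerW_eq _ _ _ _

theorem weightedIntegral_P_mul {α t : ℝ} (hα : 0 < α) (ht : 0 < t) {n : ℕ} {q : ℝ[X]}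
    (hq : q.natDegree ≤ n) :
    weightedIntegral α t (P α t n * q) = q.coeff n * h α t n := by
  have h1 := weightedIntegral_P_mul_of_degree_lt hα ht n n le_rfl (q - C (q.coeff n) * P α t n)
    (fun k hk => by
      rcases hk.eq_or_lt with rfl | hk
      · simp [coeff_P_self]
      · rw [coeff_sub, coeff_C_mul, coeff_eq_zero_of_natDegree_lt (hq.trans_lt hk),
          coeff_eq_zero_of_natDegree_lt (p := P α t n) (by rwa [P_natDegree]), mul_zero, sub_zero])
  rw [mul_sub, weightedIntegral_sub α ht, mul_left_comm, weightedIntegral_C_mul, ← h_eq] at h1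
  linarith

/-- The recurrence coefficient `β_n = h_n / h_{n-1}`, with `β_0 = 0`. -/
noncomputable def recCoeff (α t : ℝ) : ℕ → ℝ
  | 0 => 0
  | n + 1 => h α t (n + 1) / h α t n

theorem P_zero (α t : ℝ) : P α t 0 = 1 := by
  rw [P_eq]; simp

theorem P_one (α t : ℝ) : P α t 1 = X := by
  have h1 := (P_monic α t 1).as_sum
  rw [P_natDegree] at h1
  rw [h1]
  simp [coeff_P_succ α t 0]

/-- The three-term recurrence relation. -/
theorem X_mul_P {α t : ℝ} (hα : 0 < α) (ht : 0 < t) (n : ℕ) :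
    X * P α t n = P α t (n + 1) + C (recCoeff α t n) * P α t (n - 1) := by
  rcases n with _ | n
  · simp [recCoeff, P_zero, P_one]
  rw [Nat.add_sub_cancel]
  -- The defect `D` has degree at most `n`: monicity kills its coefficient in degree `n + 2`, parity
  -- the one in degree `n + 1`. It is zero because its norm is: the contributions of `P_{n+1}` and
  -- `P_n` to `∫ D² w` cancel by the choice `β_{n+1} = h_{n+1} / h_n`.
  set D := X * P α t (n + 1) - (P α t (n + 2) + C (recCoeff α t (n + 1)) * P α t n) with hD
  have hdeg : D.natDegree ≤ n := by
    rw [natDegree_le_iff_coeff_eq_zero]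
    intro k hk
    rcases k with _ | k
    · omega
    rw [hD, coeff_sub, coeff_add, coeff_X_mul, coeff_C_mul,
      coeff_eq_zero_of_natDegree_lt (p := P α t n) (by rwa [P_natDegree])]
    obtain rfl | rfl | hk2 : k = n ∨ k = n + 1 ∨ n + 1 < k := by omega
    · rw [coeff_P_succ, coeff_P_succ α t (k + 1)]; simp
    · rw [coeff_P_self, coeff_P_self]; simp
    · rw [coeff_eq_zero_of_natDegree_lt (by rwa [P_natDegree]),
        coeff_eq_zero_of_natDegree_lt (by rw [P_natDegree]; omega)]
      simp
  have h1 := weightedIntegral_P_mul hα ht (n := n + 1) (q := X * D)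
    (natDegree_mul_le_of_le natDegree_X_le hdeg |>.trans (by omega))
  have h2 := weightedIntegral_P_mul hα ht (n := n) hdeg
  have h3 := weightedIntegral_P_mul hα ht (n := n + 2) (q := D) (by omega)
  rw [coeff_eq_zero_of_natDegree_lt (by omega), zero_mul] at h3
  rw [coeff_X_mul] at h1
  have h4 : weightedIntegral α t (D * D) = 0 := by
    have e : D * D = P α t (n + 1) * (X * D) -
        (P α t (n + 2) * D + C (recCoeff α t (n + 1)) * (P α t n * D)) := by
      conv_lhs => rw [hD]
      rw [← hD]
      ring
    rw [e, weightedIntegral_sub α ht, weightedIntegral_add α ht, weightedIntegral_C_mul, h1, h2, h3,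
      recCoeff]
    have := (h_pos hα ht n).ne'
    field_simp
    ring
  by_contra hne
  have := innerW_self_pos hα ht (p := D) (sub_ne_zero.2 hne)
  rw [innerW_eq, h4] at this
  exact lt_irrefl _ this

theorem recCoeff_div_h {α t : ℝ} (hα : 0 < α) (ht : 0 < t) (n : ℕ) :
    recCoeff α t (n + 1) / h α t (n + 1) = 1 / h α t n := by
  have := (h_pos hα ht (n + 1)).ne'
  rw [recCoeff]
  field_simp

/-! ### Algebraic relations between `R_n`, `r_n` and `β_n` -/

theorem R_eq (α t : ℝ) (n : ℕ) :
    R α n t = 2 * t / h α t n * weightedIntegral (α - 1) t (P α t n * P α t n) := by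
  rw [weightedIntegral_sub_one]
  simp only [R, eval_mul, sq]

theorem r_succ_eq (α t : ℝ) (n : ℕ) :
    r α (n + 1) t =
      2 * t / h α t n * weightedIntegral (α - 1) t (X * P α t n * P α t (n + 1)) := by
  rw [weightedIntegral_sub_one, r]
  congr 2
  ext x
  simp only [eval_mul, eval_X]
  ring

/-- Normalising by `h_n` instead of `h_{n-1}` includes `n = 0`, where `β_0 = 0` makes the truncated
index `n - 1` harmless, and puts all the quantities to be compared over one factor `2t / h_n`. -/
theorem r_eq {α t : ℝ} (hα : 0 < α) (ht : 0 < t) (n : ℕ) :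
    r α n t = 2 * t / h α t n * weightedIntegral (α - 1) t
      (X * P α t n * (C (recCoeff α t n) * P α t (n - 1))) := by
  rcases n with _ | n
  · simp [r, recCoeff, weightedIntegral]
  · rw [r_succ_eq, Nat.add_sub_cancel]
    have e : X * P α t (n + 1) * (C (recCoeff α t (n + 1)) * P α t n) =
        C (recCoeff α t (n + 1)) * (X * P α t n * P α t (n + 1)) := by ring
    rw [e, weightedIntegral_C_mul]
    linear_combination (-2 * t * weightedIntegral (α - 1) t (X * P α t n * P α t (n + 1))) *
      recCoeff_div_h hα ht n

theorem recCoeff_mul_R_succ {α t : ℝ} (hα : 0 < α) (ht : 0 < t) (n : ℕ) :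
    recCoeff α t (n + 1) * R α (n + 1) t =
      2 * t / h α t n * weightedIntegral (α - 1) t (P α t (n + 1) * P α t (n + 1)) := by
  rw [R_eq]
  linear_combination (2 * t * weightedIntegral (α - 1) t (P α t (n + 1) * P α t (n + 1))) *
      recCoeff_div_h hα ht n

theorem recCoeff_mul_R_pred {α t : ℝ} (hα : 0 < α) (ht : 0 < t) (n : ℕ) :
    recCoeff α t n * R α (n - 1) t =
      2 * t / h α t n * weightedIntegral (α - 1) t
        (C (recCoeff α t n) * P α t (n - 1) * (C (recCoeff α t n) * P α t (n - 1))) := by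
  rcases n with _ | n
  · simp [recCoeff, weightedIntegral]
  · rw [R_eq, Nat.add_sub_cancel]
    have e : C (recCoeff α t (n + 1)) * P α t n * (C (recCoeff α t (n + 1)) * P α t n) =
        C (recCoeff α t (n + 1) * recCoeff α t (n + 1)) * (P α t n * P α t n) := by
      rw [C_mul]; ring
    rw [e, weightedIntegral_C_mul]
    linear_combination (-2 * t * recCoeff α t (n + 1) *
      weightedIntegral (α - 1) t (P α t n * P α t n)) * recCoeff_div_h hα ht n

/-- By the recurrence the sum is an integral of `(x P_n)²`; writing `x² = 1 - (1 - x²)` splits it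
into the `R_n` integral and `h_n`. -/
theorem r_succ_add_r {α t : ℝ} (hα : 0 < α) (ht : 0 < t) (n : ℕ) :
    r α (n + 1) t + r α n t = R α n t - 2 * t := by
  rw [r_succ_eq, r_eq hα ht, R_eq, ← mul_add, ← weightedIntegral_add _ ht, ← mul_add,
    ← X_mul_P hα ht]
  have e : X * P α t n * (X * P α t n) =
      P α t n * P α t n - (1 - X ^ 2) * (P α t n * P α t n) := by ring
  rw [e, weightedIntegral_sub _ ht, weightedIntegral_sub_one_mul, ← h_eq]
  have := (h_pos hα ht n).ne'
  field_simp

/-- With `A = P_{n+1}` and `B = β_n P_{n-1}`, so that `x P_n = A + B`, this is `(A + B)(A - B) = A²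
- B²` under the integral. -/
theorem r_succ_sub_r {α t : ℝ} (hα : 0 < α) (ht : 0 < t) (n : ℕ) :
    r α (n + 1) t - r α n t =
      recCoeff α t (n + 1) * R α (n + 1) t - recCoeff α t n * R α (n - 1) t := by
  rw [r_succ_eq, r_eq hα ht, recCoeff_mul_R_succ hα ht, recCoeff_mul_R_pred hα ht, ← mul_sub,
    ← mul_sub, ← weightedIntegral_sub _ ht, ← weightedIntegral_sub _ ht, X_mul_P hα ht]
  congr 2
  ring

/-- The subleading coefficient of `P_{n+1}` in terms of `r_n` and the recurrence coefficient. -/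
theorem two_mul_coeff_P {α t : ℝ} (hα : 0 < α) (ht : 0 < t) (n : ℕ) :
    2 * (P α t (n + 1)).coeff (n - 1) =
      r α n t - n + (2 * n - 1 + 2 * α) * recCoeff α t n := by
  rcases n with _ | m
  · simp [P_one, r, recCoeff, coeff_X]
  rw [Nat.add_sub_cancel]
  set p := (P α t (m + 2)).coeff m with hp
  have hm := (h_pos hα ht m).ne'
  -- Integrating by parts with `q = P_{m+1} P_m` makes the `w_{α-1}` term a multiple of `r_{m+1}`;
  -- orthogonality evaluates every other term.
  have key := weightedIntegral_derivative hα ht (P α t (m + 1) * P α t m)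
  have hXd : ∀ k n : ℕ, (X * derivative (P α t n)).coeff k = k * (P α t n).coeff k := by
    intro k n
    rcases k with _ | k
    · simp
    · rw [coeff_X_mul, coeff_derivative]; push_cast; ring
  have hdd : ∀ n : ℕ, (X * derivative (P α t n)).natDegree ≤ n := by
    intro n
    rw [natDegree_le_iff_coeff_eq_zero]
    intro k hk
    rw [hXd, coeff_eq_zero_of_natDegree_lt (by rwa [P_natDegree]), mul_zero]
  have h1 : weightedIntegral α t (P α t m * derivative (P α t (m + 1))) =
      (m + 1) * h α t m := by
    rw [weightedIntegral_P_mul hα ht, coeff_derivative, coeff_P_self, one_mul]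
    exact (natDegree_derivative_le _).trans (by rw [P_natDegree]; omega)
  have h2 : weightedIntegral α t (P α t (m + 1) * derivative (P α t m)) = 0 := by
    have hd : (derivative (P α t m)).natDegree ≤ m :=
      (natDegree_derivative_le _).trans (by rw [P_natDegree]; omega)
    rw [weightedIntegral_P_mul hα ht (by omega), coeff_eq_zero_of_natDegree_lt (by omega),
      zero_mul]
  have h3 : weightedIntegral α t (P α t (m + 1) * (X * (X * derivative (P α t m)))) =
      m * h α t (m + 1) := by
    rw [weightedIntegral_P_mul hα ht
      ((natDegree_mul_le_of_le natDegree_X_le (hdd m)).trans (by omega)), coeff_X_mul, hXd,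
      coeff_P_self, mul_one]
  have h4 : weightedIntegral α t (P α t (m + 1) * (X * P α t m)) = h α t (m + 1) := by
    rw [weightedIntegral_P_mul hα ht, coeff_X_mul, coeff_P_self, one_mul]
    exact (natDegree_mul_le_of_le natDegree_X_le (P_natDegree α t m).le).trans (by omega)
  have hc : (X * (X * derivative (P α t (m + 1)))).coeff m =
      (m - 1) * (p + recCoeff α t (m + 1)) := by
    have h5 := congrArg (fun q => q.coeff m) (X_mul_P hα ht (m + 1))
    simp only [coeff_add, coeff_C_mul, Nat.add_sub_cancel, coeff_P_self, mul_one] at h5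
    rw [← hp] at h5
    rw [← h5]
    rcases m with _ | k
    · simp
    · rw [coeff_X_mul, hXd, coeff_X_mul]; push_cast; ring
  have h5 : weightedIntegral α t (P α t m * (X * (X * derivative (P α t (m + 1))))) =
      ((m - 1) * (p + recCoeff α t (m + 1)) - (m + 1) * p) * h α t m := by
    -- `x² P_{m+1}'` has degree `m + 2` and leading coefficient `m + 1`; subtracting `(m + 1)
    -- P_{m+2}`, which is orthogonal to `P_m`, brings the degree down to `m`.
    have h6 := weightedIntegral_P_mul hα ht (n := m)
      (q := X * (X * derivative (P α t (m + 1))) - C ((m : ℝ) + 1) * P α t (m + 2)) (by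
        rw [natDegree_le_iff_coeff_eq_zero]
        intro k hk
        rcases k with _ | k
        · omega
        rw [coeff_sub, coeff_X_mul, hXd, coeff_C_mul]
        obtain rfl | rfl | hk2 : k = m ∨ k = m + 1 ∨ m + 1 < k := by omega
        · rw [coeff_P_succ, coeff_P_succ α t (k + 1)]; simp
        · rw [coeff_P_self, coeff_P_self]; simp
        · rw [coeff_eq_zero_of_natDegree_lt (by rwa [P_natDegree]),
            coeff_eq_zero_of_natDegree_lt (by rw [P_natDegree]; omega)]
          simp)
    have h7 : weightedIntegral α t (P α t m * P α t (m + 2)) = 0 := by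
      rw [← innerW_eq]
      exact P_orthogonal_of_lt hα ht _ _ (by omega)
    rw [mul_sub, weightedIntegral_sub α ht, mul_left_comm _ (C _), weightedIntegral_C_mul, h7,
      coeff_sub, hc, coeff_C_mul, mul_zero, sub_zero] at h6
    exact h6
  have e1 : (1 - X ^ 2) * derivative (P α t (m + 1) * P α t m) =
      P α t m * derivative (P α t (m + 1)) + P α t (m + 1) * derivative (P α t m) -
      (P α t m * (X * (X * derivative (P α t (m + 1)))) +
        P α t (m + 1) * (X * (X * derivative (P α t m)))) := by
    rw [derivative_mul]; ring
  have e2 : X * (P α t (m + 1) * P α t m) = P α t (m + 1) * (X * P α t m) := by ring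
  have e3 : X * (P α t (m + 1) * P α t m) = X * P α t m * P α t (m + 1) := by ring
  rw [e1, weightedIntegral_sub α ht, weightedIntegral_add α ht, weightedIntegral_add α ht, h1, h2,
    h3, h5, e2, h4, ← e2, e3] at key
  rw [r_succ_eq]
  rw [recCoeff] at key ⊢
  field_simp at key ⊢
  push_cast
  linear_combination key

/-- The two quadratic relations between `r_n`, `R_n` and `R_{n-1}`. -/
theorem quadratic_relations {α t : ℝ} (hα : 0 < α) (ht : 0 < t) (n : ℕ) :
    r α n t ^ 2 + 2 * t * r α n t = recCoeff α t n * R α (n - 1) t * R α n t ∧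
    -r α n t ^ 2 + 2 * (n + α - t) * r α n t + 2 * t * n =
      recCoeff α t n * ((2 * n - 1 + 2 * α) * R α n t +
        (2 * n + 1 + 2 * α) * R α (n - 1) t) := by
  induction n with
  | zero => simp [r, recCoeff]
  | succ n ih =>
    obtain ⟨ih1, ih2⟩ := ih
    have hs := r_succ_add_r hα ht n
    have hd := r_succ_sub_r hα ht n
    have hA := two_mul_coeff_P hα ht n
    have hB := two_mul_coeff_P hα ht (n + 1)
    have hX := congrArg (fun q => q.coeff n) (X_mul_P hα ht (n + 1))
    simp only [coeff_add, coeff_C_mul, Nat.add_sub_cancel, coeff_P_self, mul_one] at hX hB ⊢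
    have hc : (X * P α t (n + 1)).coeff n = (P α t (n + 1)).coeff (n - 1) := by
      rcases n with _ | n
      · simp [P_one]
      · rw [coeff_X_mul, Nat.add_sub_cancel]
    rw [hc] at hX
    push_cast at hB ⊢
    -- Comparing coefficients in the recurrence gives `p_{n+1} = p_{n+2} + β_{n+1}`; this eliminates
    -- both subleading coefficients.
    have hβ : recCoeff α t (n + 1) * (2 * n + 3 + 2 * α) -
        recCoeff α t n * (2 * n - 1 + 2 * α) = 1 - (r α (n + 1) t - r α n t) := by
      linear_combination -hB + hA - 2 * hX
    generalize r α (n + 1) t = r1 at *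
    generalize r α n t = r0 at *
    generalize R α (n + 1) t = R1 at *
    generalize R α n t = R0 at *
    generalize R α (n - 1) t = Rm at *
    generalize recCoeff α t (n + 1) = b1 at *
    generalize recCoeff α t n = b0 at *
    constructor
    -- The increment of the left side is `(r1 - r0)(r1 + r0 + 2t) = (r1 - r0) R0`, so the sum and
    -- difference formulas make the relation telescope.
    · linear_combination ih1 + (r1 - r0) * hs + R0 * hd
    · linear_combination ih2 + (1 - (r1 - r0)) * hs + (2 * n + 1 + 2 * α) * hd - R0 * hβ

/-! ### Differentiation in `t` -/

/-- A family of polynomials of bounded degree with differentiable coefficients. -/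
def PolyHasDerivAt (p : ℝ → ℝ[X]) (p' : ℝ[X]) (t : ℝ) : Prop :=
  (∃ N, p'.natDegree < N ∧ ∀ s, (p s).natDegree < N) ∧
    ∀ k, HasDerivAt (fun s => (p s).coeff k) (p'.coeff k) t

theorem PolyHasDerivAt.const (p : ℝ[X]) (t : ℝ) : PolyHasDerivAt (fun _ => p) 0 t :=
  ⟨⟨p.natDegree + 1, by simp, fun _ => Nat.lt_succ_self _⟩, fun k => hasDerivAt_const t _⟩

theorem PolyHasDerivAt.mul {p q : ℝ → ℝ[X]} {p' q' : ℝ[X]} {t : ℝ} (hp : PolyHasDerivAt p p' t)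
    (hq : PolyHasDerivAt q q' t) :
    PolyHasDerivAt (fun s => p s * q s) (p' * q t + p t * q') t := by
  obtain ⟨⟨M, hM', hM⟩, hp⟩ := hp
  obtain ⟨⟨N, hN', hN⟩, hq⟩ := hq
  refine ⟨⟨M + N, ?_, fun s => ?_⟩, fun k => ?_⟩
  · refine (natDegree_add_le _ _).trans_lt (max_lt ?_ ?_)
    · exact natDegree_mul_le.trans_lt (add_lt_add hM' (hN t))
    · exact natDegree_mul_le.trans_lt (add_lt_add (hM t) hN')
  · exact natDegree_mul_le.trans_lt (add_lt_add (hM s) (hN s))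
  · simp only [coeff_add, coeff_mul, ← Finset.sum_add_distrib]
    exact HasDerivAt.fun_sum fun x _ => (hp x.1).mul (hq x.2)

theorem PolyHasDerivAt.weightedIntegral {p : ℝ → ℝ[X]} {p' : ℝ[X]} {t : ℝ} (ht : 0 < t) (β : ℝ)
    (hp : PolyHasDerivAt p p' t) :
    HasDerivAt (fun s => weightedIntegral β s (p s))
      (PollaczekJacobi.weightedIntegral β t p' -
        PollaczekJacobi.weightedIntegral (β - 1) t (p t)) t := by
  obtain ⟨⟨N, hN', hN⟩, hp⟩ := hp
  have h1 : HasDerivAt (fun s => ∑ k ∈ Finset.range N,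
      (p s).coeff k * PollaczekJacobi.weightedIntegral β s (X ^ k))
      (∑ k ∈ Finset.range N, (p'.coeff k * PollaczekJacobi.weightedIntegral β t (X ^ k) +
        (p t).coeff k * -PollaczekJacobi.weightedIntegral (β - 1) t (X ^ k))) t :=
    HasDerivAt.fun_sum fun k _ => (hp k).mul (weightedIntegral_hasDerivAt β ht (X ^ k))
  rw [weightedIntegral_eq_sum β ht hN', weightedIntegral_eq_sum (β - 1) ht (hN t),
    ← Finset.sum_sub_distrib]
  simp only [mul_neg, ← sub_eq_add_neg] at h1
  refine h1.congr_of_eventuallyEq ?_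
  filter_upwards [lt_mem_nhds ht] with s hs
  exact weightedIntegral_eq_sum β hs (hN s)

theorem coeff_P_of_lt (α t : ℝ) {n k : ℕ} (hk : n < k) : (P α t n).coeff k = 0 :=
  coeff_eq_zero_of_natDegree_lt (by rwa [P_natDegree])

/-- Differentiability passes through Gram-Schmidt: each coefficient is a quotient of weighted
integrals of earlier differentiable families, with nonzero denominator. -/
theorem P_polyHasDerivAt {α t : ℝ} (hα : 0 < α) (ht : 0 < t) (n : ℕ) :
    ∃ p', PolyHasDerivAt (fun s => P α s n) p' t := by
  induction n using Nat.strong_induction_on with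
  | _ n ih =>
    choose! d hd using ih
    have hc : ∀ j : Fin n, ∃ c, HasDerivAt (fun s => innerW α s (P α s j) (X ^ n) /
        innerW α s (P α s j) (P α s j)) c t := by
      intro j
      have h1 := ((hd j j.isLt).mul (.const (X ^ n) t)).weightedIntegral ht α
      have h2 := ((hd j j.isLt).mul (hd j j.isLt)).weightedIntegral ht α
      simp only [← innerW_eq] at h1 h2
      exact ⟨_, h1.div h2 (innerW_self_pos hα ht (P_monic α t j).ne_zero).ne'⟩
    choose c hc using hc
    let p' : ℝ[X] := -∑ j : Fin n, (C (c j) * P α t j +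
      C (innerW α t (P α t j) (X ^ n) / innerW α t (P α t j) (P α t j)) * d j)
    refine ⟨p', ⟨max p'.natDegree n + 1, by omega, fun s => ?_⟩, fun k => ?_⟩
    · rw [P_natDegree]; omega
    · have : ∀ s, (P α s n).coeff k = (X ^ n : ℝ[X]).coeff k - ∑ j : Fin n,
          innerW α s (P α s j) (X ^ n) / innerW α s (P α s j) (P α s j) * (P α s j).coeff k := by
        intro s
        conv_lhs => rw [P_eq]
        simp only [coeff_sub, finsetSum_coeff, coeff_C_mul]
      simp only [this, p', coeff_neg, finsetSum_coeff, coeff_add, coeff_C_mul]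
      exact (HasDerivAt.fun_sum fun j _ => (hc j).mul ((hd j j.isLt).2 k)).const_sub _

theorem h_hasDerivAt {α t : ℝ} (hα : 0 < α) (ht : 0 < t) (n : ℕ) :
    HasDerivAt (fun s => h α s n) (-(h α t n * R α n t / (2 * t))) t := by
  obtain ⟨p', hp⟩ := P_polyHasDerivAt hα ht n
  have h1 := (hp.mul hp).weightedIntegral ht α
  simp only [← h_eq] at h1
  refine h1.congr_deriv ?_
  -- `P_n` stays monic, so its `t`-derivative has degree below `n` and only the derivative of the
  -- weight contributes.
  have h2 : weightedIntegral α t (P α t n * p') = 0 := by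
    refine weightedIntegral_P_mul_of_degree_lt hα ht n n le_rfl p' fun k hk => ?_
    have h3 := hp.2 k
    rcases hk.eq_or_lt with rfl | hk
    · simp only [coeff_P_self] at h3
      exact h3.unique (hasDerivAt_const t _)
    · simp only [coeff_P_of_lt _ _ hk] at h3
      exact h3.unique (hasDerivAt_const t _)
  rw [mul_comm p', weightedIntegral_add _ ht, h2, R_eq]
  have := (h_pos hα ht n).ne'
  field_simp
  ring

theorem recCoeff_hasDerivAt {α t : ℝ} (hα : 0 < α) (ht : 0 < t) (n : ℕ) :
    HasDerivAt (fun s => recCoeff α s n)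
      (recCoeff α t n * (R α (n - 1) t - R α n t) / (2 * t)) t := by
  rcases n with _ | n
  · simpa [recCoeff] using hasDerivAt_const t (0 : ℝ)
  · have := (h_pos hα ht n).ne'
    refine ((h_hasDerivAt hα ht (n + 1)).div (h_hasDerivAt hα ht n) this).congr_deriv ?_
    rw [recCoeff, Nat.add_sub_cancel]
    field_simp
    ring

/-- Differentiate `∫ P_{n+2} P_n w = 0` in `t`. Monicity and parity leave `∂_t P_{n+2}` with degree
at most `n`, so pairing it with `P_n` isolates the derivative of the wanted coefficient. -/
theorem coeff_P_hasDerivAt {α t : ℝ} (hα : 0 < α) (ht : 0 < t) (n : ℕ) :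
    HasDerivAt (fun s => (P α s (n + 1)).coeff (n - 1))
      ((r α n t - recCoeff α t n * R α (n - 1) t) / (2 * t)) t := by
  rcases n with _ | n
  · simpa [P_one, recCoeff, r] using hasDerivAt_const t (0 : ℝ)
  rw [Nat.add_sub_cancel]
  obtain ⟨p', hp⟩ := P_polyHasDerivAt hα ht (n + 2)
  obtain ⟨q', hq⟩ := P_polyHasDerivAt hα ht n
  have hcoeff : ∀ k, n < k → p'.coeff k = 0 := by
    intro k hk
    have h3 := hp.2 k
    obtain rfl | rfl | hk : k = n + 1 ∨ k = n + 2 ∨ n + 2 < k := by omega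
    · simp only [coeff_P_succ] at h3
      exact h3.unique (hasDerivAt_const t _)
    · simp only [coeff_P_self] at h3
      exact h3.unique (hasDerivAt_const t _)
    · simp only [coeff_P_of_lt _ _ hk] at h3
      exact h3.unique (hasDerivAt_const t _)
  have hqdeg : q'.natDegree ≤ n := by
    rw [natDegree_le_iff_coeff_eq_zero]
    intro k hk
    have h3 := hq.2 k
    simp only [coeff_P_of_lt _ _ hk] at h3
    exact h3.unique (hasDerivAt_const t _)
  have h1 := (hp.mul hq).weightedIntegral ht α
  have h2 : HasDerivAt (fun s => weightedIntegral α s (P α s (n + 2) * P α s n)) 0 t := by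
    refine (hasDerivAt_const t (0 : ℝ)).congr_of_eventuallyEq ?_
    filter_upwards [lt_mem_nhds ht] with s hs
    rw [mul_comm, ← innerW_eq]
    exact P_orthogonal_of_lt hα hs _ _ (by omega)
  have h3 := h1.unique h2
  have h4 : weightedIntegral α t (P α t (n + 2) * q') = 0 := by
    rw [weightedIntegral_P_mul hα ht (by omega), coeff_eq_zero_of_natDegree_lt (by omega),
      zero_mul]
  have h5 : P α t (n + 2) * P α t n =
      X * P α t n * P α t (n + 1) - C (recCoeff α t (n + 1)) * (P α t n * P α t n) := by
    have := X_mul_P hα ht (n + 1)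
    rw [Nat.add_sub_cancel] at this
    linear_combination (-P α t n) * this
  rw [weightedIntegral_add _ ht, h4, mul_comm p',
    weightedIntegral_P_mul hα ht (natDegree_le_iff_coeff_eq_zero.2 hcoeff), h5,
    weightedIntegral_sub _ ht, weightedIntegral_C_mul] at h3
  refine (hp.2 n).congr_deriv ?_
  rw [r_succ_eq, R_eq]
  have := (h_pos hα ht n).ne'
  field_simp
  linear_combination h3

/-- On the open interval `1/(1 - x²) ≥ 1`, so the integral defining `R_n` is at least `h_n`. -/
theorem R_pos {α t : ℝ} (hα : 0 < α) (ht : 0 < t) (n : ℕ) : 0 < R α n t := by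
  rw [R_eq]
  refine mul_pos (div_pos (by positivity) (h_pos hα ht n)) ?_
  refine (h_pos hα ht n).trans_le ?_
  rw [h_eq, ← weightedIntegral_sub_one_mul, sub_mul, one_mul, weightedIntegral_sub _ ht]
  refine sub_le_self _ (intervalIntegral.integral_nonneg (by norm_num) fun x hx => ?_)
  refine mul_nonneg ?_ (weight_nonneg _ _ hx)
  simp only [eval_mul, eval_pow, eval_X]
  nlinarith [sq_nonneg (x * (P α t n).eval x)]

/-! ### The closed first-order system for `r_n` and `R_n` -/

theorem r_eq_coeff {α t : ℝ} (hα : 0 < α) (ht : 0 < t) (n : ℕ) :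
    r α n t = 2 * (P α t (n + 1)).coeff (n - 1) + n - (2 * n - 1 + 2 * α) * recCoeff α t n := by
  rw [two_mul_coeff_P hα ht]; ring

theorem r_hasDerivAt_aux {α t : ℝ} (hα : 0 < α) (ht : 0 < t) (n : ℕ) :
    HasDerivAt (r α n)
      ((2 * r α n t + (2 * n - 1 + 2 * α) * (recCoeff α t n * R α n t) -
        (2 * n + 1 + 2 * α) * (recCoeff α t n * R α (n - 1) t)) / (2 * t)) t := by
  have h1 := (((coeff_P_hasDerivAt hα ht n).const_mul 2).add_const (n : ℝ)).sub
    ((recCoeff_hasDerivAt hα ht n).const_mul (2 * n - 1 + 2 * α))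
  refine (h1.congr_of_eventuallyEq ?_).congr_deriv ?_
  · filter_upwards [lt_mem_nhds ht] with s hs
    exact r_eq_coeff hα hs n
  · field_simp
    ring

/-- The derivative of `r_n` as a rational function of `t`, `r_n` and `R_n`. -/
noncomputable def rDeriv (α : ℝ) (n : ℕ) (t x y : ℝ) : ℝ :=
  (2 * x - x ^ 2 + 2 * (n + α - t) * x + 2 * t * n -
    2 * (2 * n + 1 + 2 * α) * (x ^ 2 + 2 * t * x) / y) / (2 * t)

/-- The derivative of `R_n` as a rational function of `t`, `r_n` and `R_n`. -/
noncomputable def RDeriv (α : ℝ) (n : ℕ) (t x y : ℝ) : ℝ :=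
  (y + (y + (2 * n + 1 + 2 * α)) * (y - 2 * t - 2 * x)) / (2 * t)

theorem r_hasDerivAt {α t : ℝ} (hα : 0 < α) (ht : 0 < t) (n : ℕ) :
    HasDerivAt (r α n) (rDeriv α n t (r α n t) (R α n t)) t := by
  refine (r_hasDerivAt_aux hα ht n).congr_deriv ?_
  obtain ⟨h1, h2⟩ := quadratic_relations hα ht n
  have hR := (R_pos hα ht n).ne'
  rw [rDeriv, h1]
  field_simp
  linear_combination -h2

theorem R_hasDerivAt {α t : ℝ} (hα : 0 < α) (ht : 0 < t) (n : ℕ) :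
    HasDerivAt (R α n) (RDeriv α n t (r α n t) (R α n t)) t := by
  -- `R_n = r_{n+1} + r_n + 2t` is differentiated termwise. The unreduced formula for `r_{n+1}'`
  -- avoids division by `R_{n+1}`, and the quadratic relations at `n + 1` bring it back to `r_n` and
  -- `R_n`.
  have h1 := ((r_hasDerivAt_aux hα ht (n + 1)).add (r_hasDerivAt hα ht n)).add
    ((hasDerivAt_id t).const_mul 2)
  refine (h1.congr_of_eventuallyEq ?_).congr_deriv ?_
  · filter_upwards [lt_mem_nhds ht] with s hs
    simp only [Pi.add_apply, id]
    linarith [r_succ_add_r hα hs n]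
  · obtain ⟨h3, h4⟩ := quadratic_relations hα ht (n + 1)
    have hR := (R_pos hα ht n).ne'
    have hs := r_succ_add_r hα ht n
    rw [Nat.add_sub_cancel] at h3 h4
    have hr : r α (n + 1) t = R α n t - 2 * t - r α n t := by linarith
    rw [hr] at h3 h4 ⊢
    rw [rDeriv, RDeriv]
    push_cast at h3 h4 ⊢
    field_simp
    linear_combination (-2 * (2 * n + 1 + 2 * α)) * h3 + R α n t * h4

/-! ### Smoothness, the second-order equations and Painlevé V -/

/-- Bootstrapping: the system's right-hand sides are rational with denominators `t` and `R_n`, which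
do not vanish, so each order of smoothness gives the next. -/
theorem contDiffOn_r_R {α : ℝ} (hα : 0 < α) (n k : ℕ) :
    ContDiffOn ℝ k (r α n) (Ioi 0) ∧ ContDiffOn ℝ k (R α n) (Ioi 0) := by
  induction k with
  | zero =>
    exact ⟨contDiffOn_zero.2 fun t ht => (r_hasDerivAt hα ht n).continuousAt.continuousWithinAt,
      contDiffOn_zero.2 fun t ht => (R_hasDerivAt hα ht n).continuousAt.continuousWithinAt⟩
  | succ k ih =>
    obtain ⟨h1, h2⟩ := ih
    have h2t : ∀ t ∈ Ioi (0 : ℝ), 2 * t ≠ 0 := fun t ht => (mul_pos two_pos ht).ne'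
    have hR : ∀ t ∈ Ioi (0 : ℝ), R α n t ≠ 0 := fun t ht => (R_pos hα ht n).ne'
    constructor
    · rw [Nat.cast_succ, contDiffOn_succ_iff_deriv_of_isOpen isOpen_Ioi]
      refine ⟨fun t ht => (r_hasDerivAt hα ht n).differentiableAt.differentiableWithinAt,
        by simp, ContDiffOn.congr ?_ fun t ht => (r_hasDerivAt hα ht n).deriv⟩
      unfold rDeriv
      fun_prop (disch := assumption)
    · rw [Nat.cast_succ, contDiffOn_succ_iff_deriv_of_isOpen isOpen_Ioi]
      refine ⟨fun t ht => (R_hasDerivAt hα ht n).differentiableAt.differentiableWithinAt,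
        by simp, ContDiffOn.congr ?_ fun t ht => (R_hasDerivAt hα ht n).deriv⟩
      unfold RDeriv
      fun_prop (disch := assumption)

theorem deriv_deriv_R {α t : ℝ} (hα : 0 < α) (ht : 0 < t) (n : ℕ) :
    deriv (deriv (R α n)) t =
      (deriv (R α n) t * (R α n t - 2 * t - 2 * r α n t) +
        (R α n t + (2 * n + 1 + 2 * α)) * (deriv (R α n) t - 2 - 2 * deriv (r α n) t) -
        deriv (R α n) t) / (2 * t) := by
  have hr := (r_hasDerivAt hα ht n).differentiableAt.hasDerivAt
  have hR := (R_hasDerivAt hα ht n).differentiableAt.hasDerivAt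
  have h2 := (hasDerivAt_id t).const_mul 2
  have he : deriv (R α n) =ᶠ[nhds t] fun s => RDeriv α n s (r α n s) (R α n s) :=
    (lt_mem_nhds ht).mono fun s hs => (R_hasDerivAt hα hs n).deriv
  rw [he.deriv_eq]
  refine HasDerivAt.deriv (((hR.add ((hR.add_const (2 * n + 1 + 2 * α)).mul
    ((hR.sub h2).sub (hr.const_mul 2)))).div h2 (mul_pos two_pos ht).ne').congr_deriv ?_)
  have h3 : deriv (R α n) t * (2 * t) = R α n t + (R α n t + (2 * n + 1 + 2 * α)) *
      (R α n t - 2 * t - 2 * r α n t) := by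
    rw [(R_hasDerivAt hα ht n).deriv, RDeriv]
    field_simp
  simp only [Pi.add_apply, Pi.mul_apply, Pi.sub_apply, id]
  field_simp
  linear_combination h3

theorem deriv_deriv_r {α t : ℝ} (hα : 0 < α) (ht : 0 < t) (n : ℕ) :
    deriv (deriv (r α n)) t =
      (-2 * r α n t * deriv (r α n) t + 2 * (n + α - t) * deriv (r α n) t - 2 * r α n t + 2 * n -
        2 * (2 * n + 1 + 2 * α) *
          ((2 * r α n t * deriv (r α n) t + 2 * r α n t + 2 * t * deriv (r α n) t) / R α n t -
            (r α n t ^ 2 + 2 * t * r α n t) * deriv (R α n) t / R α n t ^ 2)) / (2 * t) := by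
  have hR0 := (R_pos hα ht n).ne'
  have hr := (r_hasDerivAt hα ht n).differentiableAt.hasDerivAt
  have hR := (R_hasDerivAt hα ht n).differentiableAt.hasDerivAt
  have h1 := hasDerivAt_id t
  have h2 := h1.const_mul 2
  have he : deriv (r α n) =ᶠ[nhds t] fun s => rDeriv α n s (r α n s) (R α n s) :=
    (lt_mem_nhds ht).mono fun s hs => (r_hasDerivAt hα hs n).deriv
  rw [he.deriv_eq]
  refine HasDerivAt.deriv ((((((hr.const_mul 2).sub (hr.pow 2)).add
    (((h1.const_sub (n + α)).const_mul 2).mul hr)).add (h2.mul_const (n : ℝ))).sub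
    ((((hr.pow 2).add (h2.mul hr)).const_mul (2 * (2 * n + 1 + 2 * α))).div hR hR0)).div h2
      (mul_pos two_pos ht).ne' |>.congr_deriv ?_)
  have h3 : deriv (r α n) t * (2 * t) = 2 * r α n t - r α n t ^ 2 +
      2 * (n + α - t) * r α n t + 2 * t * n -
      2 * (2 * n + 1 + 2 * α) * (r α n t ^ 2 + 2 * t * r α n t) / R α n t := by
    rw [(r_hasDerivAt hα ht n).deriv, rDeriv]
    field_simp
  simp only [Pi.add_apply, Pi.mul_apply, Pi.sub_apply, Pi.pow_apply, Pi.div_apply, id]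
  field_simp at h3 ⊢
  push_cast
  linear_combination (R α n t) * h3

theorem R_ode {α t : ℝ} (hα : 0 < α) (ht : 0 < t) (n : ℕ) :
    8 * t ^ 2 * R α n t * (2 * n + 1 + 2 * α + R α n t) * deriv (deriv (R α n)) t
        - 4 * t ^ 2 * (4 * n + 2 + 4 * α + 3 * R α n t) * (deriv (R α n) t) ^ 2
        + 8 * t * R α n t * (2 * n + 1 + 2 * α + R α n t) * deriv (R α n) t
        - R α n t ^ 5
        - 2 * (2 * n + 1 + 2 * α) * R α n t ^ 4
        - 4 * ((n + α) * (n + 1 + α) - t * (t - 2 * α)) * R α n t ^ 3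
        + 16 * t * (2 * n + 1 + 2 * α) * (t - α) * R α n t ^ 2
        + 4 * t * (2 * n + 1 + 2 * α) ^ 2 * (5 * t - 2 * α) * R α n t
        + 8 * t ^ 2 * (2 * n + 1 + 2 * α) ^ 3 = 0 := by
  have hR0 := (R_pos hα ht n).ne'
  rw [deriv_deriv_R hα ht, (r_hasDerivAt hα ht n).deriv, (R_hasDerivAt hα ht n).deriv, rDeriv,
    RDeriv]
  field_simp
  ring

theorem r_ode {α t : ℝ} (hα : 0 < α) (ht : 0 < t) (n : ℕ) :
    4 * t ^ 2 * r α n t * (2 * t + r α n t) * deriv (deriv (r α n)) t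
        - 4 * t ^ 2 * (t + r α n t) * (deriv (r α n) t) ^ 2
        + 4 * t * r α n t ^ 2 * deriv (r α n) t
        - r α n t ^ 5
        - (2 * n + 2 * α + 5 * t) * r α n t ^ 4
        - 8 * t * (n + α + t) * r α n t ^ 3
        - 4 * t * ((t + α) ^ 2 + n * (2 * t + α) - 1) * r α n t ^ 2
        + 4 * n ^ 2 * t ^ 2 * r α n t
        + 4 * n ^ 2 * t ^ 3 = 0 := by
  have hR0 := (R_pos hα ht n).ne'
  rw [deriv_deriv_r hα ht, (r_hasDerivAt hα ht n).deriv, (R_hasDerivAt hα ht n).deriv, rDeriv,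
    RDeriv]
  field_simp
  ring

theorem W_solvesPainleveV {α : ℝ} (hα : 0 < α) (n : ℕ) :
    SolvesPainleveV ((2 * n + 1 + 2 * α) ^ 2 / 8) (-1 / 8) α (-1 / 2) (W α n) := by
  have ha : 0 < 2 * (n : ℝ) + 1 + 2 * α := by positivity
  refine ⟨(contDiffOn_const.add (contDiffOn_r_R hα n 2).2).div_const _, fun t ht => ?_⟩
  have hR := R_pos hα ht n
  have hW : W α n t = (2 * n + 1 + 2 * α + R α n t) / (2 * n + 1 + 2 * α) := rfl
  have hdW : deriv (W α n) = fun s => deriv (R α n) s / (2 * n + 1 + 2 * α) := by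
    ext s
    unfold W
    rw [deriv_div_const, deriv_const_add]
  have hddW : deriv (deriv (W α n)) t = deriv (deriv (R α n)) t / (2 * n + 1 + 2 * α) := by
    rw [hdW, deriv_div_const]
  have hW1 : W α n t - 1 = R α n t / (2 * n + 1 + 2 * α) := by
    rw [hW]
    field_simp
    ring
  have hode := R_ode hα ht n
  refine ⟨by rw [hW]; positivity, by rw [← sub_ne_zero, hW1]; positivity, ?_⟩
  rw [hddW, hW1, hdW, hW]
  have hs : 0 < 2 * n + 1 + 2 * α + R α n t := by positivity
  set a := 2 * (n : ℝ) + 1 + 2 * α with hadef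
  -- Everything is expressed in `a`; in particular `(n + α)(n + 1 + α) = (a² - 1)/4`, the source of
  -- `μ₁ = a²/8` and `μ₂ = -1/8`.
  have hn : (n : ℝ) = (a - 1 - 2 * α) / 2 := by rw [hadef]; ring
  rw [hn] at hode
  clear_value a
  field_simp
  field_simp at hode
  linear_combination (1 / 2) * hode

end PollaczekJacobi

theorem mainTheorem4 (α : ℝ) (hα : 0 < α) (n : ℕ) :
    -- `R_n` and `r_n` are twice continuously differentiable on `(0,∞)`
    ContDiffOn ℝ 2 (PollaczekJacobi.R α n) (Set.Ioi 0) ∧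
    ContDiffOn ℝ 2 (PollaczekJacobi.r α n) (Set.Ioi 0) ∧
    -- the second-order differential equation for `R_n`
    (∀ t : ℝ, 0 < t →
      let R := PollaczekJacobi.R α n
      8 * t ^ 2 * R t * (2 * n + 1 + 2 * α + R t) * deriv (deriv R) t
        - 4 * t ^ 2 * (4 * n + 2 + 4 * α + 3 * R t) * (deriv R t) ^ 2
        + 8 * t * R t * (2 * n + 1 + 2 * α + R t) * deriv R t
        - R t ^ 5
        - 2 * (2 * n + 1 + 2 * α) * R t ^ 4
        - 4 * ((n + α) * (n + 1 + α) - t * (t - 2 * α)) * R t ^ 3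
        + 16 * t * (2 * n + 1 + 2 * α) * (t - α) * R t ^ 2
        + 4 * t * (2 * n + 1 + 2 * α) ^ 2 * (5 * t - 2 * α) * R t
        + 8 * t ^ 2 * (2 * n + 1 + 2 * α) ^ 3 = 0) ∧
    -- the second-order differential equation for `r_n`
    (∀ t : ℝ, 0 < t →
      let r := PollaczekJacobi.r α n
      4 * t ^ 2 * r t * (2 * t + r t) * deriv (deriv r) t
        - 4 * t ^ 2 * (t + r t) * (deriv r t) ^ 2
        + 4 * t * r t ^ 2 * deriv r t
        - r t ^ 5
        - (2 * n + 2 * α + 5 * t) * r t ^ 4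
        - 8 * t * (n + α + t) * r t ^ 3
        - 4 * t * ((t + α) ^ 2 + n * (2 * t + α) - 1) * r t ^ 2
        + 4 * n ^ 2 * t ^ 2 * r t
        + 4 * n ^ 2 * t ^ 3 = 0) ∧
    -- `W_n` solves the fifth Painlevé equation
    PollaczekJacobi.SolvesPainleveV
      ((2 * n + 1 + 2 * α) ^ 2 / 8) (-1 / 8) α (-1 / 2) (PollaczekJacobi.W α n) := by
  exact ⟨(PollaczekJacobi.contDiffOn_r_R hα n 2).2, (PollaczekJacobi.contDiffOn_r_R hα n 2).1,
    fun t ht => PollaczekJacobi.R_ode hα ht n, fun t ht => PollaczekJacobi.r_ode hα ht n,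
    PollaczekJacobi.W_solvesPainleveV hα n⟩
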